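/- Let $k$ be a number field, and let $E(k)$ be the group of $k$-rational points (including the point at infinity) of the elliptic curve $E: y^2 = x(x+3)(x-1)$. Then there exist $a,b,c,d\in k$ such that $a^2,b^2,c^2,d^2$ is a non-constant arithmetic progression (i.e. $b^2-a^2=c^2-b^2=d^2-c^2\neq 0$) if and only if $\#E(k)>8$. Furthermore, there are infinitely many such progressions, counted as points $[a:b:c:d]\in\mathbb{P}^3(k)$ (that is, up to scaling $(a,b,c,d)$ by a common nonzero factor), if and only if $\operatorname{rank} E(k)\neq 0$. -/

import Mathlib

/-- The elliptic curve `E : y² = x (x + 3) (x - 1) = x³ + 2 x² - 3 x` over a field `k`.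
Its `k`-rational points, together with the point at infinity, form the group `(curveE k).Point`. -/
def curveE (k : Type*) [Field k] : WeierstrassCurve.Affine k where
  a₁ := 0
  a₂ := 2
  a₃ := 0
  a₄ := -3
  a₆ := 0

/-- `a 0 ^ 2, a 1 ^ 2, a 2 ^ 2, a 3 ^ 2` is an arithmetic progression in `k`. -/
def IsFourSquareAP {k : Type*} [Field k] (a : Fin 4 → k) : Prop :=
  a 1 ^ 2 - a 0 ^ 2 = a 2 ^ 2 - a 1 ^ 2 ∧ a 2 ^ 2 - a 1 ^ 2 = a 3 ^ 2 - a 2 ^ 2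

/-- `a 0 ^ 2, a 1 ^ 2, a 2 ^ 2, a 3 ^ 2` is an arithmetic progression in `k` that is not
constant, that is, its common difference is not zero. -/
def IsNonconstFourSquareAP {k : Type*} [Field k] (a : Fin 4 → k) : Prop :=
  IsFourSquareAP a ∧ a 1 ^ 2 - a 0 ^ 2 ≠ 0

/-- The points `[a 0 : a 1 : a 2 : a 3]` of `ℙ³(k)` such that `a 0 ^ 2, …, a 3 ^ 2` is a
non-constant arithmetic progression. A vector and its nonzero multiples are the same point, so
progressions are counted up to scaling of the roots. -/
def nonconstFourSquareAPs (k : Type*) [Field k] : Set (Projectivization k (Fin 4 → k)) :=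
  {P | ∃ (a : Fin 4 → k) (ha : a ≠ 0), IsNonconstFourSquareAP a ∧ P = Projectivization.mk k a ha}

open Height MvPolynomial WeierstrassCurve.Affine

/-! ### The curve and its duplication map on x-coordinates. -/

section Duplication

variable {k : Type*} [Field k]

/-! For roots (a, b, c, d) put s = a + d, u = b + c, v = d - a, w = c - b. The progression
conditions become s v = 3 u w and s² + v² = u² + w². Eliminating v shows that (s² - u²)(s² - 9u²) is
a square, and a Möbius change of s/u turns this quartic model into E. Hence nonconstant progressions
up to scaling biject with E(k) minus eight points (`nonconstPointsEquiv`).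

It remains to see that E(k) is infinite iff its rank is nonzero. Finiteness of the torsion suffices
(`finite_torsion_curveE`); it follows from h(2P) ≥ 4 h(P) + C and the Northcott property. -/

lemma curveE_equation_iff (x y : k) :
    (curveE k).Equation x y ↔ y ^ 2 = x * (x + 3) * (x - 1) := by
  rw [equation_iff]
  simp only [curveE]
  constructor <;> intro h <;> linear_combination h

lemma curveE_negY (x y : k) : (curveE k).negY x y = -y := by
  simp [negY, curveE]

lemma curveE_nonsingular_iff [CharZero k] (x y : k) :
    (curveE k).Nonsingular x y ↔ y ^ 2 = x * (x + 3) * (x - 1) := by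
  rw [nonsingular_iff, curveE_equation_iff]
  refine ⟨fun h ↦ h.1, fun h ↦ ⟨h, ?_⟩⟩
  simp only [curveE]
  by_contra! H
  obtain ⟨h₁, h₂⟩ := H
  have hy : y = 0 := by
    have : (2 : k) * y = 0 := by linear_combination h₂
    simpa using this
  subst hy
  have h₀ : x * (x + 3) * (x - 1) = 0 := by rw [← h]; ring
  rcases mul_eq_zero.mp h₀ with h₀ | h₀
  · rcases mul_eq_zero.mp h₀ with h₀ | h₀
    · subst h₀
      norm_num at h₁
    · obtain rfl : x = -3 := by linear_combination h₀
      norm_num at h₁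
  · obtain rfl : x = 1 := by linear_combination h₀
    norm_num at h₁

/-- The binary forms of degree four that give the duplication map of `curveE` on
`x`-coordinates. -/
noncomputable def duplicationForm (k : Type*) [Field k] : Fin 2 → MvPolynomial (Fin 2) k :=
  ![(X 0 ^ 2 + 3 * X 1 ^ 2) ^ 2, 4 * X 0 * X 1 * (X 0 + 3 * X 1) * (X 0 - X 1)]

lemma eval_duplicationForm (x : Fin 2 → k) :
    (fun j ↦ (duplicationForm k j).eval x) =
      ![(x 0 ^ 2 + 3 * x 1 ^ 2) ^ 2, 4 * x 0 * x 1 * (x 0 + 3 * x 1) * (x 0 - x 1)] := by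
  ext j
  fin_cases j <;> simp [duplicationForm]

/-- The binary cubic form with the given coefficients. -/
noncomputable def binaryCubic (a b c d : k) : MvPolynomial (Fin 2) k :=
  C a * X 0 ^ 3 + C b * (X 0 ^ 2 * X 1) + C c * (X 0 * X 1 ^ 2) + C d * X 1 ^ 3

lemma isHomogeneous_binaryCubic (a b c d : k) : (binaryCubic a b c d).IsHomogeneous 3 := by
  refine .add (.add (.add ?_ ?_) ?_) ?_
  · exact (isHomogeneous_X_pow 0 3).C_mul a
  · exact ((isHomogeneous_X_pow 0 2).mul (isHomogeneous_X k 1)).C_mul b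
  · exact ((isHomogeneous_X k 0).mul (isHomogeneous_X_pow 1 2)).C_mul c
  · exact (isHomogeneous_X_pow 1 3).C_mul d

lemma eval_binaryCubic (a b c d : k) (x : Fin 2 → k) : (binaryCubic a b c d).eval x =
    a * x 0 ^ 3 + b * (x 0 ^ 2 * x 1) + c * (x 0 * x 1 ^ 2) + d * x 1 ^ 3 := by
  simp [binaryCubic]

/-- Doubling multiplies the logarithmic height on `ℙ¹` by four, up to a constant. -/
lemma exists_le_logHeight_duplicationForm [CharZero k] [AdmissibleAbsValues k] :
    ∃ C, ∀ x : Fin 2 → k,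
      C + 4 * logHeight x ≤ logHeight (fun j ↦ (duplicationForm k j).eval x) := by
  -- Bézout cofactors: row i combines the two quartic forms into the seventh power of `X i`, so the
  -- forms have no common zero.
  let q : Fin 2 × Fin 2 → MvPolynomial (Fin 2) k :=
    ![![binaryCubic 1 (3 / 4) (-27 / 16) 0, binaryCubic (-3 / 16) (-45 / 64) (-9 / 32) (-81 / 64)],
      ![binaryCubic 0 (-1 / 48) (-1 / 36) (1 / 9),
        binaryCubic (1 / 192) (-1 / 288) (5 / 192) (-1 / 48)]].uncurry
  have hq a : (q a).IsHomogeneous 3 := by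
    fin_cases a <;> exact isHomogeneous_binaryCubic ..
  obtain ⟨C, hC⟩ := logHeight_eval_ge' (N := 4) hq
  refine ⟨C, fun x ↦ mod_cast hC (duplicationForm k) fun i ↦ ?_⟩
  have h₀ := congrFun (eval_duplicationForm x) 0
  have h₁ := congrFun (eval_duplicationForm x) 1
  simp only [Matrix.cons_val_zero, Matrix.cons_val_one] at h₀ h₁
  rw [Fin.sum_univ_two, h₀, h₁]
  fin_cases i <;> simp [q, eval_binaryCubic] <;> field

lemma logHeight_xRep_two_nsmul [CharZero k] [DecidableEq k] [AdmissibleAbsValues k]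
    (P : (curveE k).Point) :
    logHeight (2 • P).xRep = logHeight (fun j ↦ (duplicationForm k j).eval P.xRep) := by
  rw [eval_duplicationForm, two_nsmul]
  match P with
  | 0 => simp
  | .some x y h =>
    have hxy := (curveE_nonsingular_iff x y).mp h
    by_cases hy : y = 0
    · have h₀ : x * (x + 3) * (x - 1) = 0 := by rw [← hxy, hy]; ring
      -- x² + 3 is coprime to the cubic, so at 2-torsion the forms give [N : 0], the point at
      -- infinity.
      have hN : (x ^ 2 + 3) ^ 2 ≠ 0 := by
        refine pow_ne_zero 2 fun hx ↦ ?_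
        have : (24 : k) = 0 := by
          linear_combination (6 - (x - 1) * (x + 2)) * hx + (x - 1) * h₀
        norm_num at this
      rw [Point.add_self_of_Y_eq (by rw [curveE_negY, hy, neg_zero]),
        ← logHeight_smul_eq_logHeight _ hN]
      congr 1
      ext j
      fin_cases j
      · simp
      · simpa using h₀
    · have hD : 4 * y ^ 2 ≠ 0 := by simpa using hy
      have hne : y ≠ (curveE k).negY x y := by
        rw [curveE_negY]
        intro H
        exact hy (self_eq_neg.mp H)
      rw [Point.add_self_of_Y_ne hne, Point.xRep_some, Point.xRep_some,
        ← logHeight_smul_eq_logHeight _ hD, slope_of_Y_ne rfl hne, curveE_negY]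
      congr 1
      ext j
      fin_cases j
      · simp [addX, curveE]
        field_simp
        linear_combination (-32 - 32 * x) * hxy
      · simp
        linear_combination 4 * hxy

end Duplication

/-! ### Finite torsion and the rank. -/

section Torsion

variable (k : Type*) [Field k] [NumberField k] [DecidableEq k]

/-- Finitely many x have bounded height, and each x-coordinate comes from at most the two points ±P.
-/
instance northcott_logHeight_xRep :
    Northcott fun P : (curveE k).Point ↦ logHeight P.xRep where
  finite_le B := by
    have hfin : (insert ![1, 0] ((fun x : k ↦ ![x, 1]) '' {x | logHeight₁ x ≤ B})).Finite :=
      ((NumberField.finite_setOfPred_logHeight₁_le k B).image _).insert _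
    refine (hfin.preimage' (f := Point.xRep (W' := curveE k)) fun v _ ↦ ?_).subset fun P hP ↦ ?_
    · by_cases hv : ∃ P : (curveE k).Point, P.xRep = v
      · obtain ⟨P, rfl⟩ := hv
        refine (Set.toFinite {P, -P}).subset fun Q hQ ↦ ?_
        simpa using Point.eq_or_eq_neg_of_xRep_eq_xRep hQ
      · convert Set.finite_empty
        ext P
        simpa using fun h ↦ hv ⟨P, h⟩
    · match P with
      | 0 => simp
      | .some x y h =>
        refine .inr ⟨x, ?_, rfl⟩
        simpa [logHeight₁_eq_logHeight] using hP

theorem finite_torsion_curveE : Finite (AddCommGroup.torsion (curveE k).Point) := by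
  obtain ⟨C, hC⟩ := exists_le_logHeight_duplicationForm (k := k)
  refine AddCommGroup.finite_torsion_of_descent (n := 2) (b := 4) (c₀ := -C)
    (h := fun P : (curveE k).Point ↦ logHeight P.xRep) (by norm_num) fun P ↦ ?_
  have := hC P.xRep
  rw [logHeight_xRep_two_nsmul]
  linarith

/-- Rank zero means that every point is torsion, and the torsion is finite. -/
theorem rank_curveE_ne_zero_iff :
    Module.rank ℤ (curveE k).Point ≠ 0 ↔ Infinite (curveE k).Point := by
  rw [← not_finite_iff_infinite, not_iff_not, rank_eq_zero_iff]
  constructor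
  · intro h
    have := finite_torsion_curveE k
    refine Set.finite_univ_iff.mp <|
      (Set.toFinite (AddCommGroup.torsion (curveE k).Point : Set _)).subset fun P _ ↦ ?_
    obtain ⟨n, hn, hP⟩ := h P
    exact isOfFinAddOrder_iff_zsmul_eq_zero.mpr ⟨n, hn, hP⟩
  · intro _ P
    exact isOfFinAddOrder_iff_zsmul_eq_zero.mp (isOfFinAddOrder_of_finite P)

end Torsion

/-! ### Progressions as points of the curve. -/

section FourSquares

variable {k : Type*} [Field k]

/-- The points of `curveE` other than the eight that correspond to constant progressions. -/
def nonconstPoints (k : Type*) [Field k] : Set (curveE k).Point :=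
  {P | ∃ x y, ∃ h : (curveE k).Nonsingular x y, P = .some x y h ∧
    x ≠ 0 ∧ x ≠ -3 ∧ x ≠ 1 ∧ x ≠ -1 ∧ x ≠ 3}

lemma some_mem_nonconstPoints_iff {x y : k} (h : (curveE k).Nonsingular x y) :
    .some x y h ∈ nonconstPoints k ↔ x ≠ 0 ∧ x ≠ -3 ∧ x ≠ 1 ∧ x ≠ -1 ∧ x ≠ 3 := by
  constructor
  · rintro ⟨x', y', h', he, H⟩
    obtain ⟨rfl, rfl⟩ := Point.some.inj he
    exact H
  · exact fun H ↦ ⟨x, y, h, rfl, H⟩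

lemma zero_notMem_nonconstPoints : (0 : (curveE k).Point) ∉ nonconstPoints k := by
  rintro ⟨x, y, h, he, -⟩
  exact Point.some_ne_zero h he.symm

lemma compl_nonconstPoints [CharZero k] : (nonconstPoints k)ᶜ =
    {0, .some 0 0 ((curveE_nonsingular_iff _ _).mpr (by norm_num)),
      .some (-3) 0 ((curveE_nonsingular_iff _ _).mpr (by norm_num)),
      .some 1 0 ((curveE_nonsingular_iff _ _).mpr (by norm_num)),
      .some (-1) 2 ((curveE_nonsingular_iff _ _).mpr (by norm_num)),
      .some (-1) (-2) ((curveE_nonsingular_iff _ _).mpr (by norm_num)),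
      .some 3 6 ((curveE_nonsingular_iff _ _).mpr (by norm_num)),
      .some 3 (-6) ((curveE_nonsingular_iff _ _).mpr (by norm_num))} := by
  ext P
  match P with
  | 0 => simp [zero_notMem_nonconstPoints]
  | .some x y h =>
    have hxy := (curveE_nonsingular_iff x y).mp h
    simp only [Set.mem_compl_iff, some_mem_nonconstPoints_iff, Set.mem_insert_iff,
      Set.mem_singleton_iff, Point.some_ne_zero, Point.some.injEq, false_or]
    have key (c : k) (hc : y ^ 2 = c ^ 2) : y = c ∨ y = -c := sq_eq_sq_iff_eq_or_eq_neg.mp hc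
    constructor
    · intro H
      by_cases h₀ : x = 0
      · have : y = 0 := by simpa [h₀] using hxy
        simp [h₀, this]
      by_cases h₁ : x = -3
      · have : y = 0 := by simpa [h₁] using hxy
        simp [h₁, this]
      by_cases h₂ : x = 1
      · have : y = 0 := by simpa [h₂] using hxy
        simp [h₂, this]
      by_cases h₃ : x = -1
      · rcases key 2 (by rw [hxy, h₃]; norm_num) with h | h <;> simp [h₃, h]
      by_cases h₄ : x = 3
      · rcases key 6 (by rw [hxy, h₄]; norm_num) with h | h <;> simp [h₄, h]
      exact absurd ⟨h₀, h₁, h₂, h₃, h₄⟩ H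
    · rintro (h | h | h | h | h | h | h) <;> simp [h.1]

lemma encard_compl_nonconstPoints [CharZero k] : (nonconstPoints k)ᶜ.encard = 8 := by
  rw [compl_nonconstPoints]
  repeat rw [Set.encard_insert_of_notMem]
  · rw [Set.encard_singleton]; norm_num
  all_goals
    simp only [Set.mem_insert_iff, Set.mem_singleton_iff, Point.some.injEq, not_or,
      (Point.some_ne_zero _).symm, not_false_eq_true, and_true]
  all_goals norm_num

/-- The square roots of the progression that corresponds to the point `(x, y)` of `curveE`. -/
def progressionRoots (x y : k) : Fin 4 → k :=
  ![x * (x + 3) * (x - 3) + 3 * y * (x + 1), x * (x + 1) * (x + 3) + (x - 3) * y,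
    x * (x + 1) * (x + 3) - (x - 3) * y, x * (x + 3) * (x - 3) - 3 * y * (x + 1)]

lemma isFourSquareAP_progressionRoots {x y : k} (h : y ^ 2 = x * (x + 3) * (x - 1)) :
    IsFourSquareAP (progressionRoots x y) := by
  simp only [IsFourSquareAP, progressionRoots, Matrix.cons_val]
  constructor <;> linear_combination -8 * x * (x + 3) * h

lemma isNonconstFourSquareAP_progressionRoots [CharZero k] {x y : k}
    (h : (curveE k).Nonsingular x y) (hP : .some x y h ∈ nonconstPoints k) :
    IsNonconstFourSquareAP (progressionRoots x y) := by
  have hxy := (curveE_nonsingular_iff x y).mp h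
  obtain ⟨h₀, h₁, h₂, h₃, h₄⟩ := (some_mem_nonconstPoints_iff h).mp hP
  have hAP := isFourSquareAP_progressionRoots hxy
  refine ⟨hAP, ?_⟩
  have h₁' : x + 3 ≠ 0 := fun H ↦ h₁ (by linear_combination H)
  have h₂' : x - 1 ≠ 0 := sub_ne_zero.mpr h₂
  have h₃' : x + 1 ≠ 0 := fun H ↦ h₃ (by linear_combination H)
  have h₄' : x - 3 ≠ 0 := sub_ne_zero.mpr h₄
  have hy : y ≠ 0 := by
    rintro rfl
    have : x * (x + 3) * (x - 1) ≠ 0 := by simp [*]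
    exact this (by rw [← hxy]; ring)
  rw [hAP.1]
  have : (-4 : k) * (x * (x + 1) * (x + 3) * (x - 3) * y) ≠ 0 := by simp [*]
  convert this using 1
  simp only [progressionRoots, Matrix.cons_val]
  ring

lemma IsNonconstFourSquareAP.ne_zero {a : Fin 4 → k} (ha : IsNonconstFourSquareAP a) : a ≠ 0 := by
  rintro rfl
  simpa using ha.2

/-- The ratio s/u = (x - 3)/(x + 1) determines x; then u gives c = 1 and v gives y. -/
lemma progressionRoots_eq_smul [CharZero k] {x y x' y' c : k} (h : (curveE k).Nonsingular x y)
    (h' : (curveE k).Nonsingular x' y') (hP : .some x y h ∈ nonconstPoints k)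
    (hP' : .some x' y' h' ∈ nonconstPoints k)
    (hc : c • progressionRoots x' y' = progressionRoots x y) : x = x' ∧ y = y' := by
  obtain ⟨h₀, h₁, h₂, h₃, h₄⟩ := (some_mem_nonconstPoints_iff h).mp hP
  obtain ⟨h₀', h₁', h₂', h₃', h₄'⟩ := (some_mem_nonconstPoints_iff h').mp hP'
  have e₀ := congrFun hc 0
  have e₁ := congrFun hc 1
  have e₂ := congrFun hc 2
  have e₃ := congrFun hc 3
  simp only [progressionRoots, Pi.smul_apply, smul_eq_mul, Matrix.cons_val] at e₀ e₁ e₂ e₃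
  have k₁ : x + 3 ≠ 0 := fun H ↦ h₁ (by linear_combination H)
  have k₁' : x' + 3 ≠ 0 := fun H ↦ h₁' (by linear_combination H)
  have k₃ : x + 1 ≠ 0 := fun H ↦ h₃ (by linear_combination H)
  have hs : c * (x' * (x' + 3) * (x' - 3)) = x * (x + 3) * (x - 3) := by
    linear_combination (e₀ + e₃) / 2
  have hu : c * (x' * (x' + 1) * (x' + 3)) = x * (x + 1) * (x + 3) := by
    linear_combination (e₁ + e₂) / 2
  have hv : c * (y' * (x' + 1)) = y * (x + 1) := by
    linear_combination (e₀ - e₃) / 6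
  have hx : x = x' := by
    have h : (4 * (x * (x + 3) * (x' * (x' + 3)))) * (x - x') = 0 := by
      linear_combination (x' * (x' + 3) * (x' - 3)) * hu - (x' * (x' + 1) * (x' + 3)) * hs
    have h' : 4 * (x * (x + 3) * (x' * (x' + 3))) ≠ 0 := by simp [*]
    exact sub_eq_zero.mp ((mul_eq_zero.mp h).resolve_left h')
  subst hx
  have hc : c = 1 := by
    have h : x * (x + 1) * (x + 3) ≠ 0 := by simp [*]
    exact mul_right_cancel₀ h (by rw [hu, one_mul])
  subst hc
  exact ⟨rfl, mul_right_cancel₀ k₃ (by linear_combination -hv)⟩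

lemma IsNonconstFourSquareAP.exists_nonconstPoint [CharZero k] {a : Fin 4 → k}
    (ha : IsNonconstFourSquareAP a) :
    ∃ (x y c : k), ∃ h : (curveE k).Nonsingular x y, .some x y h ∈ nonconstPoints k ∧
      c • a = progressionRoots x y := by
  obtain ⟨⟨e₁, e₂⟩, h⟩ := ha
  obtain ⟨s, hs⟩ : ∃ s, s = a 0 + a 3 := ⟨_, rfl⟩
  obtain ⟨u, hu⟩ : ∃ u, u = a 1 + a 2 := ⟨_, rfl⟩
  obtain ⟨v, hv⟩ : ∃ v, v = a 3 - a 0 := ⟨_, rfl⟩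
  obtain ⟨w, hw⟩ : ∃ w, w = a 2 - a 1 := ⟨_, rfl⟩
  have huw : u * w ≠ 0 := by
    rw [hu, hw]
    convert h using 1
    linear_combination -e₁
  have hsv : s * v = 3 * (u * w) := by
    rw [hs, hv, hu, hw]
    linear_combination e₁ - e₂
  have hq : s ^ 2 + v ^ 2 = u ^ 2 + w ^ 2 := by
    rw [hs, hv, hu, hw]
    linear_combination -2 * e₁ - 2 * e₂
  have hu₀ := left_ne_zero_of_mul huw
  have hw₀ := right_ne_zero_of_mul huw
  have hs₀ : s ≠ 0 := left_ne_zero_of_mul (b := v) (by rw [hsv]; simpa using huw)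
  -- Eliminating v gives s²(s² - u²) = w²(s² - 9u²), so with s, u, w nonzero neither factor in
  -- parentheses vanishes.
  have hsu : s ^ 2 ≠ u ^ 2 := by
    intro H
    have : 8 * (u * w) ^ 2 = 0 := by
      linear_combination (-s * v - 3 * (u * w)) * hsv + s ^ 2 * hq + (w ^ 2 - s ^ 2) * H
    simp_all
  have hsu₃ : s ^ 2 ≠ 9 * u ^ 2 := by
    intro H
    have : 72 * (u ^ 2 * u ^ 2) = 0 := by
      linear_combination 9 * u ^ 2 * hq - (s * v + 3 * (u * w)) * hsv + (v ^ 2 - 9 * u ^ 2) * H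
    simp_all
  have hd : s - u ≠ 0 := fun H ↦ hsu (by linear_combination (s + u) * H)
  have hd₁ : s + u ≠ 0 := fun H ↦ hsu (by linear_combination (s - u) * H)
  have hd₂ : s - 3 * u ≠ 0 := fun H ↦ hsu₃ (by linear_combination (s + 3 * u) * H)
  have hd₃ : s + 3 * u ≠ 0 := fun H ↦ hsu₃ (by linear_combination (s - 3 * u) * H)
  -- The Möbius map sending s/u = -3, 3, -1, 1 to x = 0, -3, 1, ∞; it sends 0 and ∞ to 3 and -1. The
  -- formula for y inverts v/u = -3y/(x(x + 3)).
  obtain ⟨x, hx⟩ : ∃ x, x = -(s + 3 * u) / (s - u) := ⟨_, rfl⟩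
  obtain ⟨y, hy⟩ : ∃ y, y = -(v * x * (x + 3)) / (3 * u) := ⟨_, rfl⟩
  have hx₁ : x + 3 = 2 * (s - 3 * u) / (s - u) := by rw [hx]; field
  have hx₂ : x - 1 = -2 * (s + u) / (s - u) := by rw [hx]; field
  have hx₃ : x + 1 = -4 * u / (s - u) := by rw [hx]; field
  have hx₄ : x - 3 = -4 * s / (s - u) := by rw [hx]; field
  have hns : (curveE k).Nonsingular x y := by
    rw [curveE_nonsingular_iff, hy, hx₁, hx₂, hx]
    field_simp
    linear_combination (s * v + 3 * (u * w)) * hsv - 9 * u ^ 2 * hq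
  have hyu : 3 * u * y = -(v * x * (x + 3)) := by rw [hy]; field
  have hxs : (x - 3) * u = (x + 1) * s := by rw [hx₃, hx₄]; field
  have hyw : u * ((x - 3) * y) = - (x * (x + 1) * (x + 3)) * w := by
    refine mul_left_cancel₀ (mul_ne_zero three_ne_zero hu₀) ?_
    linear_combination (x - 3) * u * hyu - v * x * (x + 3) * hxs - x * (x + 3) * (x + 1) * hsv
  -- The scale factor compares the values of u: for `progressionRoots x y` it is 2x(x + 1)(x + 3).
  refine ⟨x, y, 2 * (x * (x + 1) * (x + 3)) / u, hns,
    (some_mem_nonconstPoints_iff hns).mpr ⟨?_, ?_, ?_, ?_, ?_⟩, ?_⟩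
  · rw [hx]
    exact div_ne_zero (neg_ne_zero.mpr hd₃) hd
  · rw [← sub_ne_zero, sub_neg_eq_add, hx₁]
    exact div_ne_zero (mul_ne_zero two_ne_zero hd₂) hd
  · rw [← sub_ne_zero, hx₂]
    exact div_ne_zero (mul_ne_zero (by norm_num) hd₁) hd
  · rw [← sub_ne_zero, sub_neg_eq_add, hx₃]
    exact div_ne_zero (mul_ne_zero (by norm_num) hu₀) hd
  · rw [← sub_ne_zero, hx₄]
    exact div_ne_zero (mul_ne_zero (by norm_num) hs₀) hd
  · have a₀ : a 0 = (s - v) / 2 := by rw [hs, hv]; ring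
    have a₁ : a 1 = (u - w) / 2 := by rw [hu, hw]; ring
    have a₂ : a 2 = (u + w) / 2 := by rw [hu, hw]; ring
    have a₃ : a 3 = (s + v) / 2 := by rw [hs, hv]; ring
    ext i
    fin_cases i <;>
      simp only [progressionRoots, Pi.smul_apply, smul_eq_mul, Matrix.cons_val, Fin.zero_eta,
        Fin.mk_one, Fin.reduceFinMk, a₀, a₁, a₂, a₃] <;> field_simp
    · linear_combination -x * (x + 3) * hxs - (x + 1) * hyu
    · linear_combination -hyw
    · linear_combination hyw
    · linear_combination -x * (x + 3) * hxs + (x + 1) * hyu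

/-- The square roots of the progression that corresponds to a point of `curveE`. -/
def pointRoots : (curveE k).Point → Fin 4 → k
  -- Infinity corresponds to the constant progression with roots (1, 1, 1, 1).
  | 0 => 1
  | .some x y _ => progressionRoots x y

lemma isNonconstFourSquareAP_pointRoots [CharZero k] {P : (curveE k).Point}
    (hP : P ∈ nonconstPoints k) : IsNonconstFourSquareAP (pointRoots P) := by
  match P with
  | 0 => exact absurd hP zero_notMem_nonconstPoints
  | .some x y h => exact isNonconstFourSquareAP_progressionRoots h hP

/-- Nonconstant progressions up to scaling correspond to points of `curveE`. -/
noncomputable def nonconstPointsEquiv (k : Type*) [Field k] [CharZero k] :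
    nonconstPoints k ≃ nonconstFourSquareAPs k :=
  .ofBijective
    (fun P ↦ ⟨.mk k (pointRoots P.1) (isNonconstFourSquareAP_pointRoots P.2).ne_zero,
      _, _, isNonconstFourSquareAP_pointRoots P.2, rfl⟩) <| by
    constructor
    · rintro ⟨_, x, y, h, rfl, H⟩ ⟨_, x', y', h', rfl, H'⟩ he
      obtain ⟨c, hc⟩ := (Projectivization.mk_eq_mk_iff' ..).mp (congrArg Subtype.val he)
      obtain ⟨rfl, rfl⟩ := progressionRoots_eq_smul h h' ⟨x, y, h, rfl, H⟩ ⟨x', y', h', rfl, H'⟩ hc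
      rfl
    · rintro ⟨_, a, ha, hap, rfl⟩
      obtain ⟨x, y, c, h, hP, hc⟩ := hap.exists_nonconstPoint
      exact ⟨⟨.some x y h, hP⟩,
        Subtype.ext ((Projectivization.mk_eq_mk_iff' ..).mpr ⟨c, hc⟩)⟩

end FourSquares

theorem proposition2 (k : Type*) [Field k] [NumberField k] [DecidableEq k] :
    ((∃ a : Fin 4 → k, IsNonconstFourSquareAP a) ↔ 8 < ENat.card (curveE k).Point) ∧
    ((nonconstFourSquareAPs k).Infinite ↔ Module.rank ℤ (curveE k).Point ≠ 0) := by
  constructor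
  · have hcard : ENat.card (curveE k).Point = (nonconstPoints k).encard + 8 := by
      rw [← encard_compl_nonconstPoints (k := k), Set.encard_add_encard_compl, Set.encard_univ]
    have hex : (∃ a : Fin 4 → k, IsNonconstFourSquareAP a) ↔ (nonconstPoints k).Nonempty := by
      constructor
      · rintro ⟨a, ha⟩
        obtain ⟨x, y, c, h, hP, -⟩ := ha.exists_nonconstPoint
        exact ⟨_, hP⟩
      · rintro ⟨P, hP⟩
        exact ⟨_, isNonconstFourSquareAP_pointRoots hP⟩
    rw [hex, hcard, ← Set.encard_pos]
    refine ⟨fun h ↦ ?_, fun h ↦ ?_⟩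
    · simpa using (ENat.add_lt_add_iff_right (k := 8) (by decide)).mpr h
    · rw [pos_iff_ne_zero]
      intro h₀
      simp [h₀] at h
  · have hfin : (nonconstPoints k)ᶜ.Finite :=
      Set.finite_of_encard_eq_coe (encard_compl_nonconstPoints (k := k))
    rw [rank_curveE_ne_zero_iff, ← Set.infinite_coe_iff, ← (nonconstPointsEquiv k).infinite_iff,
      Set.infinite_coe_iff, ← Set.infinite_univ_iff, ← Set.union_compl_self (nonconstPoints k),
      Set.infinite_union]
    simp [Set.not_infinite.mpr hfin]
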